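/- Let $\zeta^{(k)}$ denote the $k$-th derivative of the Riemann zeta function. For every integer $k \ge 1$ and every $a \in \mathbb{C}$ there exist real numbers $E_1 = E_1(k,a) \le 0$ and $E_2 = E_2(k,a) \ge 1$ with the following properties. (i) $|\zeta^{(k)}(s)| > |a|$ for all $s \in \mathbb{C}$ with $\operatorname{Re} s \le E_1$ and $|\operatorname{Im} s| \ge 1$. (ii) If $a \ne 0$, then $|\zeta^{(k)}(s)| < |a|$ for all $s \in \mathbb{C}$ with $\operatorname{Re} s \ge E_2$. (iii) For every $a$, including $a = 0$, $\zeta^{(k)}$ has no $a$-points (that is, no solutions of $\zeta^{(k)}(s) = a$) in either of the two regions $\{s : \operatorname{Re} s \le E_1,\ |\operatorname{Im} s| \ge 1\}$ and $\{s : \operatorname{Re} s \ge E_2\}$. -/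

import Mathlib

open Complex Filter Topology

/-! Left region: put `w = 1 - s` and `f w = ζ (1 - w)`. The functional equation gives `f'/f =
digamma w - log (2π) - (π/2) tan (πw/2) + (ζ'/ζ) w`. For `re w > 2` and `|im w| > η > 0` everything
but digamma is bounded, while `re (digamma w)` tends to infinity with `re w`, so `f'/f` is uniformly
large. This passes to derivatives: with `L = f'/f`, one has `f''/f' = L + L'/L`, and `L'/L` is
bounded because `L'` is bounded and `|L| ≥ 1` (`HasLargeLogDeriv.deriv`). Hence `|f^(k)| ≥ M^k |f|`
far to the right, for any prescribed `M`. It remains to bound `|f|` below: the reflection formula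
does so on one vertical line, and `re (f'/f) ≥ 0` makes `|f|` nondecreasing to the right of it
(`norm_riemannZeta_one_sub_ge`). Right half-plane: for `k ≥ 1` the Dirichlet series of `ζ^(k)`
starts at `n = 2`. It is therefore `O(2^(-re s))`, and its first term eventually dominates the rest,
which excludes zeros. -/

/-! ### Series for digamma and bounds on it -/

lemma inv_succ_le_log_div (n : ℕ) :
    1 / ((n : ℝ) + 2) ≤ Real.log ((n + 2) / (n + 1)) := by
  have h := Real.one_sub_inv_le_log_of_pos (x := ((n : ℝ) + 2) / (n + 1)) (by positivity)
  have e : 1 - (((n : ℝ) + 2) / (n + 1))⁻¹ = 1 / (n + 2) := by field_simp; ring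
  linarith

lemma log_div_le_inv_succ (n : ℕ) :
    Real.log (((n : ℝ) + 2) / (n + 1)) ≤ 1 / (n + 1) := by
  have h := Real.log_le_sub_one_of_pos (x := ((n : ℝ) + 2) / (n + 1)) (by positivity)
  have e : ((n : ℝ) + 2) / (n + 1) - 1 = 1 / (n + 1) := by field_simp; ring
  linarith

lemma norm_add_succ_ge {w : ℂ} (hw : 0 < w.re) (n : ℕ) : (n : ℝ) + 1 ≤ ‖(n : ℂ) + 1 + w‖ := by
  refine le_trans ?_ (Complex.re_le_norm _)
  simp; linarith

lemma add_succ_ne_zero {w : ℂ} (hw : 0 < w.re) (n : ℕ) : (n : ℂ) + 1 + w ≠ 0 := by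
  rw [← norm_pos_iff]
  have := norm_add_succ_ge hw n
  have h0 : (0 : ℝ) < n + 1 := by positivity
  linarith

/-- The general term of the series for the digamma function. -/
noncomputable def digammaTerm (n : ℕ) (w : ℂ) : ℂ :=
  (Real.log ((n + 2) / (n + 1)) : ℝ) - 1 / ((n : ℂ) + 1 + w)

/-- The general term of the series for `log (Gamma (w + 1))`. -/
noncomputable def logGammaTerm (n : ℕ) (w : ℂ) : ℂ :=
  w * (Real.log ((n + 2) / (n + 1)) : ℝ) - (log ((n : ℂ) + 1 + w) - Real.log (n + 1))

lemma hasDerivAt_logGammaTerm (n : ℕ) {w : ℂ} (hw : 0 < w.re) :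
    HasDerivAt (logGammaTerm n) (digammaTerm n w) w := by
  have h1 : HasDerivAt (fun z : ℂ ↦ (n : ℂ) + 1 + z) 1 w := (hasDerivAt_id w).const_add _
  have h2 := h1.clog (Or.inl (by simp; positivity))
  have h3 := ((hasDerivAt_id w).mul_const ((Real.log ((n + 2) / (n + 1)) : ℝ) : ℂ)).sub
    (h2.sub_const ((Real.log (n + 1) : ℝ) : ℂ))
  rw [one_mul] at h3
  exact h3

lemma norm_digammaTerm_le (n : ℕ) {w : ℂ} (hw : 0 < w.re) :
    ‖digammaTerm n w‖ ≤ (1 + ‖w‖) * (1 / ((n : ℝ) + 1) ^ 2) := by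
  have e : digammaTerm n w = ((Real.log ((n + 2) / (n + 1)) - 1 / (n + 1) : ℝ) : ℂ)
      + w / (((n : ℂ) + 1) * ((n : ℂ) + 1 + w)) := by
    have h1 := add_succ_ne_zero hw n
    have h2 : (n : ℂ) + 1 ≠ 0 := Nat.cast_add_one_ne_zero n
    simp only [digammaTerm]
    push_cast
    field_simp
    ring
  have h0 : (0 : ℝ) < n + 1 := by positivity
  rw [e]
  rw [add_mul (1 : ℝ), one_mul]
  refine (norm_add_le _ _).trans (add_le_add ?_ ?_)
  · rw [norm_real, Real.norm_eq_abs, abs_le]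
    have h1 := inv_succ_le_log_div n
    have h2 := log_div_le_inv_succ n
    have h3 : 1 / ((n : ℝ) + 1) - 1 / (n + 2) ≤ 1 / (n + 1) ^ 2 := by
      rw [div_sub_div _ _ (by positivity) (by positivity), div_le_div_iff₀ (by positivity) (by positivity)]
      nlinarith
    have h4 : 0 ≤ 1 / ((n : ℝ) + 1) ^ 2 := by positivity
    constructor <;> linarith
  · rw [norm_div, norm_mul, div_eq_mul_one_div]
    have h2 : ‖(n : ℂ) + 1‖ = n + 1 := by
      rw [← Nat.cast_add_one, Complex.norm_natCast]; simp
    rw [h2, sq]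
    gcongr
    exact norm_add_succ_ge hw n

lemma summable_one_div_succ_sq : Summable fun n : ℕ ↦ 1 / ((n : ℝ) + 1) ^ 2 := by
  have := (summable_nat_add_iff 1).mpr (Real.summable_one_div_nat_pow.mpr one_lt_two)
  simpa using this

lemma summable_digammaTerm {w : ℂ} (hw : 0 < w.re) : Summable fun n ↦ digammaTerm n w :=
  Summable.of_norm_bounded (summable_one_div_succ_sq.mul_left _)
    fun n ↦ norm_digammaTerm_le n hw

/-- Using `log ((n + 2) / (n + 1))` instead of `1 / (n + 1)` makes every term vanish at `1`, a free
base point for summability, and keeps Euler's constant out of the formulas. -/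
lemma logGammaTerm_one (n : ℕ) : logGammaTerm n 1 = 0 := by
  have h : ((n : ℂ) + 1 + 1) = (((n : ℝ) + 2 : ℝ) : ℂ) := by push_cast; ring
  rw [logGammaTerm, h, ← ofReal_log (by positivity), Real.log_div (by positivity) (by positivity)]
  push_cast
  ring

lemma exp_logGammaTerm (n : ℕ) {w : ℂ} (hw : 0 < w.re) :
    exp (logGammaTerm n w) =
      ((n : ℂ) + 2) ^ w / ((n : ℂ) + 1) ^ w * (((n : ℂ) + 1) / ((n : ℂ) + 1 + w)) := by
  have h1 : (n : ℂ) + 1 ≠ 0 := Nat.cast_add_one_ne_zero n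
  have h2 : (n : ℂ) + 2 ≠ 0 := by exact_mod_cast Nat.succ_ne_zero (n + 1)
  rw [logGammaTerm, exp_sub, exp_sub, exp_log (add_succ_ne_zero hw n), cpow_def_of_ne_zero h1,
    cpow_def_of_ne_zero h2, ← exp_sub, Real.log_div (by positivity) (by positivity)]
  have e1 : log ((n : ℂ) + 1) = (Real.log (n + 1) : ℝ) := by
    rw [ofReal_log (by positivity)]; simp
  have e2 : log ((n : ℂ) + 2) = (Real.log (n + 2) : ℝ) := by
    rw [ofReal_log (by positivity)]; simp
  have e3 : exp (Real.log (n + 1) : ℝ) = (n : ℂ) + 1 := by rw [← e1, exp_log h1]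
  rw [e1, e2, e3, div_div_eq_mul_div, mul_div_assoc]
  congr 2
  push_cast
  ring

/-- The logarithms telescope. The factor `w` cancels the `j = 0` factor in the denominator of
`GammaSeq`; the last factor, which tends to `1`, cancels `j = N + 1` and turns `(N + 1)!` into `N!`.
-/
lemma exp_sum_logGammaTerm (N : ℕ) {w : ℂ} (hw : 0 < w.re) :
    exp (∑ n ∈ Finset.range N, logGammaTerm n w) =
      GammaSeq w (N + 1) * w * (((N : ℂ) + 1 + w) / ((N : ℂ) + 1)) := by
  have hw0 : w ≠ 0 := by rintro rfl; simp at hw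
  induction N with
  | zero =>
    have h := add_succ_ne_zero hw 0
    simp only [Nat.cast_zero, zero_add] at h
    have h' : w + 1 ≠ 0 := by rwa [add_comm]
    simp [GammaSeq, Finset.prod_range_succ]
    field_simp
    ring
  | succ N ih =>
    have h1 : (N : ℂ) + 1 ≠ 0 := Nat.cast_add_one_ne_zero N
    have h2 : (N : ℂ) + 2 ≠ 0 := by exact_mod_cast Nat.succ_ne_zero (N + 1)
    have h3 := add_succ_ne_zero hw N
    have h4 := add_succ_ne_zero hw (N + 1)
    have h5 : ((N : ℂ) + 1) ^ w ≠ 0 := by simp [cpow_eq_zero_iff, h1]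
    push_cast at h4
    have h6 : (N : ℂ) + 1 + 1 = N + 2 := by ring
    rw [h6] at h4
    have h7 : ∏ j ∈ Finset.range (N + 1 + 1), (w + (j : ℂ)) ≠ 0 := by
      refine Finset.prod_ne_zero_iff.mpr fun j _ h ↦ ?_
      have := congrArg re h
      simp at this
      have : (0 : ℝ) ≤ j := j.cast_nonneg
      linarith
    rw [Finset.sum_range_succ, exp_add, ih, exp_logGammaTerm N hw]
    simp only [GammaSeq]
    rw [Finset.prod_range_succ _ (N + 1 + 1), Nat.factorial_succ (N + 1)]
    push_cast
    rw [h6]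
    have h8 : w + ((N : ℂ) + 2) ≠ 0 := by rwa [add_comm]
    field_simp
    ring

lemma summable_logGammaTerm_and_hasDerivAt {w : ℂ} (hw : 0 < w.re) :
    Summable (fun n ↦ logGammaTerm n w) ∧
      HasDerivAt (fun z ↦ ∑' n, logGammaTerm n z) (∑' n, digammaTerm n w) w := by
  -- The ball must contain both `w` and the base point `1`; its boundedness makes the majorant of
  -- the differentiated series uniform.
  set R := ‖w‖ + 2
  let t : Set ℂ := {z | 0 < z.re} ∩ Metric.ball 0 R
  have hto : IsOpen t := (isOpen_lt continuous_const continuous_re).inter Metric.isOpen_ball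
  have htc : IsPreconnected t :=
    ((convex_halfSpace_re_gt 0).inter (convex_ball 0 R)).isPreconnected
  have hd : ∀ n z, z ∈ t → HasDerivAt (logGammaTerm n) (digammaTerm n z) z :=
    fun n z hz ↦ hasDerivAt_logGammaTerm n hz.1
  have hb : ∀ n z, z ∈ t → ‖digammaTerm n z‖ ≤ (1 + R) * (1 / ((n : ℝ) + 1) ^ 2) := by
    intro n z hz
    refine (norm_digammaTerm_le n hz.1).trans ?_
    have : ‖z‖ < R := by simpa using hz.2
    gcongr
  have h1 : (1 : ℂ) ∈ t := ⟨by simp, by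
    simp only [R, Metric.mem_ball, dist_zero_right, norm_one]
    linarith [norm_nonneg w]⟩
  have hwt : w ∈ t := ⟨hw, by simp [R]⟩
  have h0 : Summable fun n ↦ logGammaTerm n 1 := by simp [logGammaTerm_one]
  exact ⟨summable_of_summable_hasDerivAt_of_isPreconnected
      (summable_one_div_succ_sq.mul_left (1 + R)) hto htc hd hb h1 h0 hwt,
    hasDerivAt_tsum_of_isPreconnected
      (summable_one_div_succ_sq.mul_left (1 + R)) hto htc hd hb h1 h0 hwt⟩

lemma exp_tsum_logGammaTerm {w : ℂ} (hw : 0 < w.re) :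
    exp (∑' n, logGammaTerm n w) = Gamma w * w := by
  have h1 := (continuous_exp.tendsto _).comp
    (summable_logGammaTerm_and_hasDerivAt hw).1.hasSum.tendsto_sum_nat
  have h2 : Tendsto (fun N : ℕ ↦ ((N : ℂ) + 1 + w) / ((N : ℂ) + 1)) atTop (𝓝 1) := by
    have h3 : Tendsto (fun N : ℕ ↦ 1 + w * (1 / ((N : ℂ) + 1))) atTop (𝓝 (1 + w * 0)) :=
      (tendsto_one_div_add_atTop_nhds_zero_nat.const_mul w).const_add 1
    rw [mul_zero, add_zero] at h3
    refine h3.congr fun N ↦ ?_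
    have : (N : ℂ) + 1 ≠ 0 := Nat.cast_add_one_ne_zero N
    field_simp
  have h4 := (((GammaSeq_tendsto_Gamma w).comp (tendsto_add_atTop_nat 1)).mul_const w).mul h2
  rw [mul_one] at h4
  refine tendsto_nhds_unique (h1.congr fun N ↦ ?_) h4
  exact exp_sum_logGammaTerm N hw

lemma digamma_eq_tsum {w : ℂ} (hw : 0 < w.re) :
    digamma w = ∑' n, digammaTerm n w - 1 / w := by
  have hw0 : w ≠ 0 := by rintro rfl; simp at hw
  have hG : Gamma w ≠ 0 := Gamma_ne_zero_of_re_pos hw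
  have hd : DifferentiableAt ℂ Gamma w := differentiableAt_Gamma _ fun m h ↦ by
    rw [h] at hw
    simp at hw
    linarith [(Nat.cast_nonneg m : (0 : ℝ) ≤ m)]
  have h1 : HasDerivAt (fun z ↦ exp (∑' n, logGammaTerm n z)) _ w :=
    (summable_logGammaTerm_and_hasDerivAt hw).2.cexp
  have h2 : HasDerivAt (fun z ↦ Gamma z * z) _ w := hd.hasDerivAt.mul (hasDerivAt_id w)
  have h3 : (fun z ↦ exp (∑' n, logGammaTerm n z)) =ᶠ[𝓝 w] fun z ↦ Gamma z * z := by
    filter_upwards [(isOpen_lt continuous_const continuous_re).mem_nhds hw] with z hz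
    exact exp_tsum_logGammaTerm hz
  have h4 := h1.unique (h2.congr_of_eventuallyEq h3)
  rw [exp_tsum_logGammaTerm hw] at h4
  rw [digamma_def, logDeriv_apply]
  simp only [mul_one] at h4
  field_simp
  linear_combination -h4

/-- All terms have nonnegative real part once `re w ≥ 1`, so the tail can be dropped. The first `N`
logarithms telescope to `log (N + 1)`; their fractions cost at most `N / re w ≤ 1`, and `1 / w`
costs at most `1` more. -/
lemma re_digamma_ge (N : ℕ) {w : ℂ} (hw : (N : ℝ) + 1 ≤ w.re) :
    Real.log (N + 1) - 2 ≤ (digamma w).re := by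
  have hN : (0 : ℝ) ≤ N := N.cast_nonneg
  have hw1 : 1 ≤ w.re := by linarith
  have hw0 : 0 < w.re := by linarith
  have hre : ∀ z : ℂ, 0 < z.re → (1 / z).re ≤ 1 / z.re := by
    intro z hz
    refine (re_le_norm _).trans ?_
    rw [norm_div, norm_one]
    exact one_div_le_one_div_of_le hz (re_le_norm z)
  have hterm : ∀ n : ℕ, Real.log ((n + 2) / (n + 1)) - 1 / (n + 1 + w.re) ≤
      (digammaTerm n w).re := by
    intro n
    have h := hre ((n : ℂ) + 1 + w) (by simp; positivity)
    simp only [add_re, natCast_re, one_re] at h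
    rw [digammaTerm, sub_re, ofReal_re]
    linarith
  have hnn : ∀ n : ℕ, 0 ≤ (digammaTerm n w).re := by
    intro n
    refine le_trans ?_ (hterm n)
    have h1 := inv_succ_le_log_div n
    have h2 : 1 / ((n : ℝ) + 1 + w.re) ≤ 1 / (n + 2) :=
      one_div_le_one_div_of_le (by positivity) (by linarith)
    linarith
  have hs := summable_digammaTerm hw0
  have h1 : ∑ n ∈ Finset.range N, (digammaTerm n w).re ≤ (∑' n, digammaTerm n w).re := by
    rw [re_tsum hs]
    exact (hasSum_re hs.hasSum).summable.sum_le_tsum _ fun n _ ↦ hnn n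
  have h2 : Real.log (N + 1) - N / w.re ≤ ∑ n ∈ Finset.range N, (digammaTerm n w).re := by
    clear h1 hw hN
    induction N with
    | zero => simp
    | succ N ih =>
      rw [Finset.sum_range_succ]
      have h := hterm N
      rw [Real.log_div (by positivity) (by positivity)] at h
      have h3 : 1 / ((N : ℝ) + 1 + w.re) ≤ 1 / w.re :=
        one_div_le_one_div_of_le hw0 (by linarith [(N.cast_nonneg : (0 : ℝ) ≤ N)])
      have h4 : (N : ℝ) + 1 + 1 = N + 2 := by ring
      push_cast
      rw [h4, add_div]
      linarith
  have h3 : (N : ℝ) / w.re ≤ 1 := by rw [div_le_one hw0]; linarith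
  have h4 : (1 / w).re ≤ 1 := (hre w hw0).trans (by rw [div_le_one hw0]; exact hw1)
  rw [digamma_eq_tsum hw0, sub_re]
  linarith

/-- A termwise Lipschitz estimate suffices, so the series need not be differentiated again. -/
lemma norm_deriv_digamma_le : ∃ C : ℝ, ∀ w : ℂ, 1 < w.re → ‖deriv digamma w‖ ≤ C := by
  refine ⟨∑' n : ℕ, 1 / ((n : ℝ) + 1) ^ 2 + 1, fun w hw ↦ norm_deriv_le_of_lip' ?_ ?_⟩
  · have : 0 ≤ ∑' n : ℕ, 1 / ((n : ℝ) + 1) ^ 2 := tsum_nonneg fun n ↦ by positivity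
    positivity
  filter_upwards [(isOpen_lt continuous_const continuous_re).mem_nhds hw] with z hz
  have hz : 1 < z.re := hz
  have hw0 : 0 < w.re := by linarith
  have hz0 : 0 < z.re := by linarith
  have hwn : w ≠ 0 := by rintro rfl; simp at hw0
  have hzn : z ≠ 0 := by rintro rfl; simp at hz0
  rw [digamma_eq_tsum hw0, digamma_eq_tsum hz0]
  have e1 : ∑' n, digammaTerm n z - 1 / z - (∑' n, digammaTerm n w - 1 / w) =
      ∑' n, (digammaTerm n z - digammaTerm n w) + (z - w) / (z * w) := by
    rw [(summable_digammaTerm hz0).tsum_sub (summable_digammaTerm hw0)]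
    field_simp
    ring
  rw [e1, add_mul, one_mul]
  refine (norm_add_le _ _).trans (add_le_add ?_ ?_)
  · rw [mul_comm]
    refine tsum_of_norm_bounded (summable_one_div_succ_sq.hasSum.mul_left _) fun n ↦ ?_
    have e2 : digammaTerm n z - digammaTerm n w =
        (z - w) / (((n : ℂ) + 1 + z) * ((n : ℂ) + 1 + w)) := by
      have h1 := add_succ_ne_zero hw0 n
      have h2 := add_succ_ne_zero hz0 n
      simp only [digammaTerm]
      field_simp
      ring
    rw [e2, norm_div, norm_mul, div_eq_mul_one_div, sq]
    have h0 : (0 : ℝ) < n + 1 := by positivity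
    gcongr
    · exact norm_add_succ_ge hz0 n
    · exact norm_add_succ_ge hw0 n
  · rw [norm_div, norm_mul]
    refine div_le_self (norm_nonneg _) (one_le_mul_of_one_le_of_one_le ?_ ?_)
    · exact hz.le.trans (re_le_norm z)
    · exact hw.le.trans (re_le_norm w)

/-! ### Stability of a large logarithmic derivative under differentiation -/

/-- The two-component region `{w | σ < re w, η < |im w|}`. -/
def quarterPlanes (σ η : ℝ) : Set ℂ := {w | σ < w.re ∧ η < |w.im|}

lemma isOpen_quarterPlanes (σ η : ℝ) : IsOpen (quarterPlanes σ η) :=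
  (isOpen_lt continuous_const continuous_re).inter
    (isOpen_lt continuous_const (continuous_abs.comp continuous_im))

lemma quarterPlanes_mono {σ σ' η η' : ℝ} (hσ : σ ≤ σ') (hη : η ≤ η') :
    quarterPlanes σ' η' ⊆ quarterPlanes σ η :=
  fun _ hw ↦ ⟨hσ.trans_lt hw.1, hη.trans_lt hw.2⟩

lemma closedBall_subset_quarterPlanes {σ η : ℝ} {w : ℂ}
    (hw : w ∈ quarterPlanes (σ + 1) η) :
    Metric.closedBall w (min 1 (η / 2)) ⊆ quarterPlanes σ (η / 2) := by
  intro z hz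
  rw [Metric.mem_closedBall, dist_eq_norm] at hz
  obtain ⟨h1, h2⟩ := hw
  have h3 := (abs_re_le_norm (z - w)).trans hz
  have h4 := (abs_im_le_norm (z - w)).trans hz
  rw [sub_re] at h3
  rw [sub_im] at h4
  have h5 := abs_le.mp (h3.trans (min_le_left _ _))
  have h6 := h4.trans (min_le_right _ _)
  have h7 := abs_sub_abs_le_abs_sub w.im z.im
  rw [abs_sub_comm] at h7
  exact ⟨by linarith, by linarith⟩

/-- Cauchy's estimate on discs of fixed radius, at the price of a smaller region. -/
lemma norm_deriv_le_of_bounded_quarterPlanes {σ η C : ℝ} (hη : 0 < η) {g : ℂ → ℂ}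
    (hd : DifferentiableOn ℂ g (quarterPlanes σ (η / 2)))
    (hC : ∀ w ∈ quarterPlanes σ (η / 2), ‖g w‖ ≤ C) {w : ℂ}
    (hw : w ∈ quarterPlanes (σ + 1) η) :
    ‖deriv g w‖ ≤ C / min 1 (η / 2) := by
  have hr : 0 < min 1 (η / 2) := by positivity
  have hsub := closedBall_subset_quarterPlanes hw
  refine norm_deriv_le_of_forall_mem_sphere_norm_le hr ?_ fun z hz ↦
    hC z (hsub (Metric.sphere_subset_closedBall hz))
  refine DifferentiableOn.diffContOnCl ?_
  rw [closure_ball _ hr.ne']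
  exact hd.mono hsub

/-- Far to the right with `|im w| > η`, the function `f` is holomorphic without zeros, its
logarithmic derivative has bounded derivative, and it is uniformly large. -/
def HasLargeLogDeriv (f : ℂ → ℂ) (η : ℝ) : Prop :=
  (∃ σ C : ℝ, DifferentiableOn ℂ f (quarterPlanes σ η) ∧
    (∀ w ∈ quarterPlanes σ η, f w ≠ 0) ∧
    ∀ w ∈ quarterPlanes σ η, ‖deriv (logDeriv f) w‖ ≤ C) ∧
  ∀ M : ℝ, ∃ σ : ℝ, ∀ w ∈ quarterPlanes σ η, M ≤ ‖logDeriv f w‖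

lemma DifferentiableOn.logDeriv_of_isOpen {f : ℂ → ℂ} {s : Set ℂ} (hs : IsOpen s)
    (hf : DifferentiableOn ℂ f s) (h0 : ∀ w ∈ s, f w ≠ 0) :
    DifferentiableOn ℂ (logDeriv f) s :=
  (hf.deriv hs).div hf h0

/-- With `L = logDeriv f`, the new logarithmic derivative is `L + H`, where `H = L'/L` is bounded
and `H'` is controlled by Cauchy's estimate. That estimate shrinks the region, so the hypothesis is
taken for every `η` and used at `η / 2`. -/
lemma HasLargeLogDeriv.deriv {f : ℂ → ℂ} (h : ∀ η : ℝ, 0 < η → HasLargeLogDeriv f η)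
    {η : ℝ} (hη : 0 < η) : HasLargeLogDeriv (deriv f) η := by
  obtain ⟨⟨σ₀, C, hd, hne, hC⟩, hM⟩ := h (η / 2) (half_pos hη)
  obtain ⟨σ₁, h1⟩ := hM 1
  set σ := max σ₀ σ₁
  set U := quarterPlanes σ (η / 2)
  have hU : IsOpen U := isOpen_quarterPlanes _ _
  have hU0 : U ⊆ quarterPlanes σ₀ (η / 2) := quarterPlanes_mono (le_max_left _ _) le_rfl
  have hU1 : U ⊆ quarterPlanes σ₁ (η / 2) := quarterPlanes_mono (le_max_right _ _) le_rfl
  have hdU := hd.mono hU0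
  have hLd : DifferentiableOn ℂ (logDeriv f) U :=
    hdU.logDeriv_of_isOpen hU fun w hw ↦ hne w (hU0 hw)
  have hL0 : ∀ w ∈ U, logDeriv f w ≠ 0 := fun w hw ↦ by
    rw [← norm_pos_iff]; linarith [h1 w (hU1 hw)]
  have hf' : ∀ w ∈ U, _root_.deriv f w = logDeriv f w * f w := fun w hw ↦ by
    rw [logDeriv_apply, div_mul_cancel₀ _ (hne w (hU0 hw))]
  set H : ℂ → ℂ := fun w ↦ _root_.deriv (logDeriv f) w / logDeriv f w
  have hHd : DifferentiableOn ℂ H U := (hLd.deriv hU).div hLd hL0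
  have hHC : ∀ w ∈ U, ‖H w‖ ≤ C := fun w hw ↦ by
    rw [norm_div]
    exact (div_le_self (norm_nonneg _) (h1 w (hU1 hw))).trans (hC w (hU0 hw))
  have hlog : ∀ w ∈ U, logDeriv (_root_.deriv f) w = logDeriv f w + H w := fun w hw ↦ by
    have hev : _root_.deriv f =ᶠ[𝓝 w] fun z ↦ logDeriv f z * f z := by
      filter_upwards [hU.mem_nhds hw] with z hz using hf' z hz
    have hLw := hLd.differentiableAt (hU.mem_nhds hw)
    have hfw := hdU.differentiableAt (hU.mem_nhds hw)
    rw [logDeriv_apply, hev.deriv_eq, hev.eq_of_nhds,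
      deriv_fun_mul hLw hfw, hf' w hw]
    have := hL0 w hw
    have := hne w (hU0 hw)
    simp only [H]
    field_simp
    ring
  have hsub : quarterPlanes (σ + 1) η ⊆ U := quarterPlanes_mono (by linarith) (by linarith)
  refine ⟨⟨σ + 1, C + C / min 1 (η / 2), (hdU.deriv hU).mono hsub, fun w hw ↦ ?_, fun w hw ↦ ?_⟩,
    fun M ↦ ?_⟩
  · rw [hf' w (hsub hw)]
    exact mul_ne_zero (hL0 w (hsub hw)) (hne w (hU0 (hsub hw)))
  · have hwU := hsub hw
    have hev : logDeriv (_root_.deriv f) =ᶠ[𝓝 w] fun z ↦ logDeriv f z + H z := by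
      filter_upwards [hU.mem_nhds hwU] with z hz using hlog z hz
    rw [hev.deriv_eq, deriv_fun_add (hLd.differentiableAt (hU.mem_nhds hwU))
      (hHd.differentiableAt (hU.mem_nhds hwU))]
    exact (norm_add_le _ _).trans (add_le_add (hC w (hU0 hwU))
      (norm_deriv_le_of_bounded_quarterPlanes hη hHd hHC hw))
  -- The extra `C` absorbs `H`.
  · obtain ⟨σ₂, h2⟩ := hM (M + C)
    refine ⟨max σ₂ σ, fun w hw ↦ ?_⟩
    have hwU : w ∈ U := quarterPlanes_mono (le_max_right _ _) (by linarith) hw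
    have hw2 := h2 w (quarterPlanes_mono (le_max_left _ _) (by linarith) hw)
    rw [hlog w hwU]
    have h3 := norm_sub_le (logDeriv f w + H w) (H w)
    rw [add_sub_cancel_right] at h3
    linarith [hHC w hwU]

lemma HasLargeLogDeriv.iteratedDeriv {f : ℂ → ℂ}
    (h : ∀ η : ℝ, 0 < η → HasLargeLogDeriv f η) (k : ℕ) :
    ∀ η : ℝ, 0 < η → HasLargeLogDeriv (iteratedDeriv k f) η := by
  induction k with
  | zero => simpa using h
  | succ k ih =>
    intro η hη
    rw [iteratedDeriv_succ]
    exact HasLargeLogDeriv.deriv ih hη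

lemma HasLargeLogDeriv.norm_iteratedDeriv_ge {f : ℂ → ℂ}
    (h : ∀ η : ℝ, 0 < η → HasLargeLogDeriv f η) {η M : ℝ} (hη : 0 < η) (hM : 0 ≤ M) (k : ℕ) :
    ∃ σ : ℝ, ∀ w ∈ quarterPlanes σ η, M ^ k * ‖f w‖ ≤ ‖_root_.iteratedDeriv k f w‖ := by
  induction k with
  | zero => exact ⟨0, fun w _ ↦ by simp⟩
  | succ k ih =>
    obtain ⟨σ₁, h1⟩ := ih
    obtain ⟨⟨σ₂, C, -, hne, -⟩, hL⟩ := HasLargeLogDeriv.iteratedDeriv h k η hη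
    obtain ⟨σ₃, h3⟩ := hL M
    refine ⟨max σ₁ (max σ₂ σ₃), fun w hw ↦ ?_⟩
    have hw1 := h1 w (quarterPlanes_mono (by simp) le_rfl hw)
    have hw2 := hne w (quarterPlanes_mono (by simp) le_rfl hw)
    have hw3 := h3 w (quarterPlanes_mono (by simp) le_rfl hw)
    have e : _root_.iteratedDeriv (k + 1) f w =
        logDeriv (_root_.iteratedDeriv k f) w * _root_.iteratedDeriv k f w := by
      rw [iteratedDeriv_succ, logDeriv_apply, div_mul_cancel₀ _ hw2]
    rw [e, norm_mul, pow_succ', mul_assoc]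
    exact mul_le_mul hw3 hw1 (by positivity) (norm_nonneg _)

/-! ### Zeta and its logarithmic derivative on `re s ≥ 2` -/

lemma LSeries_bounded_of_two_le_re {f : ℕ → ℂ} (hf : LSeriesSummable f 2) :
    ∃ K : ℝ, 0 ≤ K ∧ ∀ s : ℂ, 2 ≤ s.re → ‖LSeries f s‖ ≤ K := by
  refine ⟨∑' n, ‖LSeries.term f 2 n‖, tsum_nonneg fun _ ↦ norm_nonneg _, fun s hs ↦ ?_⟩
  exact tsum_of_norm_bounded (Summable.norm hf).hasSum
    fun n ↦ LSeries.norm_term_le_of_re_le_re f (by simpa using hs) n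

/-- `1 / ζ` is the Möbius Dirichlet series, which is bounded here. -/
lemma norm_riemannZeta_ge : ∃ c : ℝ, 0 < c ∧ ∀ s : ℂ, 2 ≤ s.re → c ≤ ‖riemannZeta s‖ := by
  obtain ⟨K, hK, h⟩ := LSeries_bounded_of_two_le_re
    (ArithmeticFunction.LSeriesSummable_moebius_iff.mpr (by simp : 1 < (2 : ℂ).re))
  refine ⟨1 / (K + 1), by positivity, fun s hs ↦ ?_⟩
  have hs1 : 1 < s.re := by linarith
  have e := ArithmeticFunction.LSeries_zeta_mul_Lseries_moebius hs1
  rw [ArithmeticFunction.LSeries_zeta_eq_riemannZeta hs1] at e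
  have e' := congrArg norm e
  rw [norm_mul, norm_one] at e'
  rw [div_le_iff₀ (by positivity), ← e']
  gcongr
  linarith [h s hs]

lemma norm_logDeriv_riemannZeta_le :
    ∃ C : ℝ, ∀ s : ℂ, 2 ≤ s.re → ‖logDeriv riemannZeta s‖ ≤ C := by
  obtain ⟨K, -, h⟩ := LSeries_bounded_of_two_le_re
    (ArithmeticFunction.LSeriesSummable_vonMangoldt (s := 2) (by simp))
  refine ⟨K, fun s hs ↦ ?_⟩
  have h1 := h s hs
  rwa [ArithmeticFunction.LSeries_vonMangoldt_eq_deriv_riemannZeta_div (by linarith), neg_div,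
    norm_neg] at h1

/-! ### Cosine and tangent off the real axis -/

lemma sq_norm_cos (z : ℂ) : ‖cos z‖ ^ 2 = Real.cos z.re ^ 2 + Real.sinh z.im ^ 2 := by
  rw [Complex.sq_norm, cos_eq, ← ofReal_cos, ← ofReal_sin, ← ofReal_cosh, ← ofReal_sinh,
    normSq_apply]
  simp only [sub_re, sub_im, mul_re, mul_im, ofReal_re, ofReal_im, I_re, I_im]
  linear_combination Real.cos z.re ^ 2 * Real.cosh_sq z.im + Real.sinh z.im ^ 2 * Real.sin_sq_add_cos_sq z.re

lemma sq_norm_sin (z : ℂ) : ‖sin z‖ ^ 2 = Real.sin z.re ^ 2 + Real.sinh z.im ^ 2 := by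
  rw [Complex.sq_norm, sin_eq, ← ofReal_cos, ← ofReal_sin, ← ofReal_cosh, ← ofReal_sinh,
    normSq_apply]
  simp only [add_re, add_im, mul_re, mul_im, ofReal_re, ofReal_im, I_re, I_im]
  linear_combination Real.sin z.re ^ 2 * Real.cosh_sq z.im + Real.sinh z.im ^ 2 * Real.sin_sq_add_cos_sq z.re

lemma sinh_abs_im_le_norm_cos (z : ℂ) : Real.sinh |z.im| ≤ ‖cos z‖ := by
  rw [← Real.abs_sinh]
  refine abs_le_of_sq_le_sq' ?_ (norm_nonneg _) |>.2
  rw [sq_abs, sq_norm_cos]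
  nlinarith [sq_nonneg (Real.cos z.re)]

lemma cos_ne_zero_of_im_ne_zero {z : ℂ} (hz : z.im ≠ 0) : cos z ≠ 0 := by
  rw [← norm_pos_iff]
  exact (Real.sinh_pos_iff.mpr (abs_pos.mpr hz)).trans_le (sinh_abs_im_le_norm_cos z)

lemma norm_tan_le {η : ℝ} (hη : 0 < η) {z : ℂ} (hz : η < |z.im|) :
    ‖tan z‖ ≤ 1 + 1 / Real.sinh η := by
  have h0 : 0 < Real.sinh η := Real.sinh_pos_iff.mpr hη
  have h1 : Real.sinh η ≤ ‖cos z‖ :=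
    (Real.sinh_le_sinh.mpr hz.le).trans (sinh_abs_im_le_norm_cos z)
  have h2 : ‖sin z‖ ≤ 1 + ‖cos z‖ := by
    refine abs_le_of_sq_le_sq' ?_ (by positivity) |>.2
    nlinarith [sq_norm_sin z, sq_norm_cos z, Real.sin_sq_add_cos_sq z.re, norm_nonneg (cos z),
      sq_nonneg (Real.cos z.re)]
  have h3 : 0 < ‖cos z‖ := h0.trans_le h1
  rw [tan_eq_sin_div_cos, norm_div, div_le_iff₀ h3, add_mul, one_mul]
  have h4 : 1 ≤ 1 / Real.sinh η * ‖cos z‖ := by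
    rw [one_div_mul_eq_div, one_le_div h0]; exact h1
  linarith

/-! ### Gamma on vertical lines -/

lemma sq_norm_Gamma_one_add_mul_I {y : ℝ} (hy : y ≠ 0) :
    ‖Gamma (1 + y * I)‖ ^ 2 = Real.pi * |y| / Real.sinh (Real.pi * |y|) := by
  have hz : (y : ℂ) * I ≠ 0 := by simp [hy]
  have h1 := Gamma_mul_Gamma_one_sub ((y : ℂ) * I)
  have h2 := Gamma_add_one _ hz
  have h3 : Gamma (1 - y * I) = (starRingEnd ℂ) (Gamma (1 + y * I)) := by
    rw [← Gamma_conj]; simp [sub_eq_add_neg]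
  have h4 : ‖Gamma (1 - y * I)‖ = ‖Gamma (1 + y * I)‖ := by rw [h3, norm_conj]
  have h5 : Gamma (1 + y * I) * Gamma (1 - y * I) = y * I * (Real.pi / sin (Real.pi * (y * I))) := by
    rw [← h1, add_comm, h2]; ring
  have h6 := congrArg norm h5
  rw [norm_mul, h4, ← mul_assoc, sin_mul_I, ← ofReal_mul, ← ofReal_sinh] at h6
  simp only [norm_mul, norm_div, norm_real, norm_I, mul_one, Real.norm_eq_abs, Real.abs_sinh,
    abs_mul, abs_of_pos Real.pi_pos] at h6
  rw [sq, h6]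
  ring

/-- The decay of Gamma is offset by the growth of sinh: with `u = π|y|/2` the squared product is `u
tanh u`, which exceeds `1/9` for `u ≥ 1/2`. The sinh later bounds the cosine of the functional
equation from below. -/
lemma norm_Gamma_one_add_mul_I_mul_sinh_ge {y : ℝ} (hy : 1 / 2 ≤ |y|) :
    1 / 3 ≤ ‖Gamma (1 + y * I)‖ * Real.sinh (Real.pi * |y| / 2) := by
  set u := Real.pi * |y| / 2
  have hy0 : y ≠ 0 := by rintro rfl; norm_num at hy
  have hu : 1 / 2 ≤ u := by
    have := Real.pi_gt_three
    simp only [u]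
    nlinarith
  have hs : u ≤ Real.sinh u := Real.self_le_sinh_iff.mpr (by linarith)
  have hs0 : 0 < Real.sinh u := by linarith
  have hc : Real.cosh u ≤ Real.sinh u + 1 := by
    have h1 := Real.cosh_sub_sinh u
    have h2 : Real.exp (-u) ≤ 1 := Real.exp_le_one_iff.mpr (by linarith)
    linarith
  have hc0 := Real.cosh_pos u
  refine abs_le_of_sq_le_sq' ?_ (by positivity) |>.2
  have e : Real.pi * |y| = 2 * u := by simp only [u]; ring
  rw [mul_pow, sq_norm_Gamma_one_add_mul_I hy0, e, Real.sinh_two_mul]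
  have e2 : 2 * u / (2 * Real.sinh u * Real.cosh u) * Real.sinh u ^ 2 =
      u * Real.sinh u / Real.cosh u := by
    field_simp
  rw [e2, le_div_iff₀ hc0]
  nlinarith

lemma norm_Gamma_nat_add_mul_I_mul_sinh_ge (N : ℕ) {y : ℝ} (hy : 1 / 2 ≤ |y|) :
    1 / 3 ≤ ‖Gamma (N + 1 + y * I)‖ * Real.sinh (Real.pi * |y| / 2) := by
  induction N with
  | zero => simpa using norm_Gamma_one_add_mul_I_mul_sinh_ge hy
  | succ N ih =>
    have h1 : (1 : ℝ) ≤ ‖(N + 1 + y * I : ℂ)‖ := by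
      refine le_trans ?_ (re_le_norm _)
      simp
    have h2 : (N + 1 + y * I : ℂ) ≠ 0 := by
      rw [← norm_pos_iff]; linarith
    have e : ((N + 1 : ℕ) + 1 + y * I : ℂ) = (N + 1 + y * I) + 1 := by push_cast; ring
    rw [e, Gamma_add_one _ h2, norm_mul, mul_assoc]
    exact ih.trans (le_mul_of_one_le_left (by linarith) h1)

/-! ### The functional equation and the logarithmic derivative of `ζ (1 - w)` -/

lemma riemannZeta_one_sub_of_one_lt_re {w : ℂ} (hw : 1 < w.re) :
    riemannZeta (1 - w) =
      2 * (2 * Real.pi) ^ (-w) * Gamma w * cos (Real.pi * w / 2) * riemannZeta w := by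
  refine riemannZeta_one_sub (fun n h ↦ ?_) fun h ↦ ?_
  · rw [h] at hw
    simp at hw
    linarith [(n.cast_nonneg : (0 : ℝ) ≤ n)]
  · rw [h] at hw; simp at hw

lemma pi_mul_div_two_im (w : ℂ) : ((Real.pi : ℂ) * w / 2).im = Real.pi / 2 * w.im := by
  have e : (Real.pi : ℂ) * w / 2 = ((Real.pi / 2 : ℝ) : ℂ) * w := by push_cast; ring
  rw [e, im_ofReal_mul]

lemma abs_pi_mul_div_two_im (w : ℂ) :
    |((Real.pi : ℂ) * w / 2).im| = Real.pi * |w.im| / 2 := by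
  rw [pi_mul_div_two_im, abs_mul, abs_of_pos (by positivity)]
  ring

/-- An integral real part lets the reflection formula on `re = 1` and the recursion for Gamma
replace Stirling's formula. -/
lemma norm_riemannZeta_one_sub_nat_ge (N : ℕ) :
    ∃ c : ℝ, 0 < c ∧ ∀ w : ℂ, w.re = N + 2 → 1 / 2 ≤ |w.im| → c ≤ ‖riemannZeta (1 - w)‖ := by
  obtain ⟨c, hc, h⟩ := norm_riemannZeta_ge
  have hN : (0 : ℝ) ≤ N := N.cast_nonneg
  refine ⟨2 * (2 * Real.pi) ^ (-((N : ℝ) + 2)) * (1 / 3) * c, by positivity, fun w hw hy ↦ ?_⟩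
  rw [riemannZeta_one_sub_of_one_lt_re (by linarith), norm_mul, mul_assoc (_ * _) (Gamma w),
    norm_mul, norm_mul, norm_mul]
  have e1 : ‖(2 * Real.pi : ℂ) ^ (-w)‖ = (2 * Real.pi) ^ (-((N : ℝ) + 2)) := by
    have : (2 * Real.pi : ℂ) = ((2 * Real.pi : ℝ) : ℂ) := by push_cast; ring
    rw [this, norm_cpow_eq_rpow_re_of_pos (by positivity), neg_re, hw]
  have e2 : ‖(2 : ℂ)‖ = 2 := by simp
  rw [e1, e2]
  have e3 : w = ((N + 1 : ℕ) : ℂ) + 1 + w.im * I := by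
    apply Complex.ext
    · simp [hw]; ring
    · simp
  have h1 := norm_Gamma_nat_add_mul_I_mul_sinh_ge (N + 1) hy
  rw [← e3] at h1
  have h2 := sinh_abs_im_le_norm_cos (Real.pi * w / 2)
  rw [abs_pi_mul_div_two_im] at h2
  gcongr
  · exact h1.trans (by gcongr)
  · exact h w (by linarith)

lemma differentiableAt_riemannZeta_one_sub {w : ℂ} (hw : w ≠ 0) :
    DifferentiableAt ℂ (fun z ↦ riemannZeta (1 - z)) w :=
  (differentiableAt_riemannZeta (s := 1 - w) (by simpa using hw)).comp w (by fun_prop)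

/-- The bounded part of the logarithmic derivative of `fun w ↦ riemannZeta (1 - w)`. -/
noncomputable def zetaLogDerivRemainder (w : ℂ) : ℂ :=
  -log (2 * Real.pi) - Real.pi / 2 * tan (Real.pi * w / 2) + logDeriv riemannZeta w

lemma logDeriv_riemannZeta_one_sub {w : ℂ} (hw : 1 < w.re) (him : w.im ≠ 0) :
    riemannZeta (1 - w) ≠ 0 ∧
    logDeriv (fun z ↦ riemannZeta (1 - z)) w = digamma w + zetaLogDerivRemainder w := by
  have hev : (fun z ↦ riemannZeta (1 - z)) =ᶠ[𝓝 w] fun z ↦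
      2 * (2 * Real.pi) ^ (-z) * Gamma z * cos (Real.pi * z / 2) * riemannZeta z := by
    filter_upwards [(isOpen_lt continuous_const continuous_re).mem_nhds hw] with z hz
    exact riemannZeta_one_sub_of_one_lt_re hz
  have hpi : (2 * Real.pi : ℂ) ≠ 0 := by
    simp
  have hpow : HasDerivAt (fun z : ℂ ↦ (2 * (2 * Real.pi) ^ (-z) : ℂ))
      (2 * ((2 * Real.pi) ^ (-w) * log (2 * Real.pi) * -1)) w :=
    ((hasDerivAt_neg w).const_cpow (Or.inl hpi)).const_mul 2
  have hpow0 : (2 * (2 * Real.pi) ^ (-w) : ℂ) ≠ 0 := by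
    simp [cpow_eq_zero_iff]
  have hG0 : Gamma w ≠ 0 := Gamma_ne_zero_of_re_pos (by linarith)
  have hG : DifferentiableAt ℂ Gamma w := differentiableAt_Gamma _ fun m h ↦ by
    rw [h] at hw
    simp at hw
    linarith [(m.cast_nonneg : (0 : ℝ) ≤ m)]
  have hc0 : cos (Real.pi * w / 2) ≠ 0 := cos_ne_zero_of_im_ne_zero (by
    rw [pi_mul_div_two_im]; exact mul_ne_zero (by positivity) him)
  have hc : HasDerivAt (fun z : ℂ ↦ cos (Real.pi * z / 2))
      (-sin (Real.pi * w / 2) * (Real.pi * 1 / 2)) w :=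
    (((hasDerivAt_id w).const_mul (Real.pi : ℂ)).div_const 2).ccos
  have hz0 : riemannZeta w ≠ 0 := riemannZeta_ne_zero_of_one_lt_re hw
  have hz : DifferentiableAt ℂ riemannZeta w :=
    differentiableAt_riemannZeta (by rintro rfl; simp at hw)
  have h1 := hpow.differentiableAt.fun_mul hG
  have h2 := h1.fun_mul hc.differentiableAt
  refine ⟨?_, ?_⟩
  · rw [hev.eq_of_nhds]
    exact mul_ne_zero (mul_ne_zero (mul_ne_zero hpow0 hG0) hc0) hz0
  have e : logDeriv (fun z ↦ riemannZeta (1 - z)) w = logDeriv (fun z ↦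
      2 * (2 * Real.pi) ^ (-z) * Gamma z * cos (Real.pi * z / 2) * riemannZeta z) w := by
    rw [logDeriv_apply, hev.deriv_eq, hev.eq_of_nhds, logDeriv_apply]
  rw [e, logDeriv_mul
      (f := fun z : ℂ ↦ 2 * (2 * Real.pi) ^ (-z) * Gamma z * cos (Real.pi * z / 2)) w
      (mul_ne_zero (mul_ne_zero hpow0 hG0) hc0) hz0 h2 hz,
    logDeriv_mul (f := fun z : ℂ ↦ 2 * (2 * Real.pi) ^ (-z) * Gamma z) w
      (mul_ne_zero hpow0 hG0) hc0 h1 hc.differentiableAt,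
    logDeriv_mul (f := fun z : ℂ ↦ (2 * (2 * Real.pi) ^ (-z) : ℂ)) w hpow0 hG0 hpow.differentiableAt hG,
    logDeriv_apply (fun z : ℂ ↦ (2 * (2 * Real.pi) ^ (-z) : ℂ)), hpow.deriv,
    logDeriv_apply (fun z : ℂ ↦ cos (Real.pi * z / 2)), hc.deriv, zetaLogDerivRemainder,
    digamma_def, tan_eq_sin_div_cos]
  have hp : ((2 * Real.pi) ^ (-w) : ℂ) ≠ 0 := by simp [cpow_eq_zero_iff]
  field_simp
  ring

lemma norm_zetaLogDerivRemainder_le {η : ℝ} (hη : 0 < η) :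
    ∃ C : ℝ, ∀ w ∈ quarterPlanes 2 η, ‖zetaLogDerivRemainder w‖ ≤ C := by
  obtain ⟨K, hK⟩ := norm_logDeriv_riemannZeta_le
  refine ⟨‖-log (2 * Real.pi : ℂ)‖ + ‖(Real.pi / 2 : ℂ)‖ * (1 + 1 / Real.sinh η) + K,
    fun w hw ↦ ?_⟩
  refine (norm_add_le _ _).trans (add_le_add ((norm_sub_le _ _).trans ?_) (hK w hw.1.le))
  rw [norm_mul]
  gcongr
  refine norm_tan_le hη ?_
  rw [abs_pi_mul_div_two_im]
  nlinarith [Real.pi_gt_three, hw.2]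

lemma differentiableAt_digamma {w : ℂ} (hw : 0 < w.re) : DifferentiableAt ℂ digamma w := by
  have hd : DifferentiableOn ℂ Gamma {z | 0 < z.re} := fun z hz ↦
    (differentiableAt_Gamma z fun m h ↦ by
      have hz : 0 < z.re := hz
      rw [h] at hz
      simp at hz
      linarith [(m.cast_nonneg : (0 : ℝ) ≤ m)]).differentiableWithinAt
  have ho : IsOpen {z : ℂ | 0 < z.re} := isOpen_lt continuous_const continuous_re
  exact (hd.logDeriv_of_isOpen ho fun z hz ↦ Gamma_ne_zero_of_re_pos hz).differentiableAt
    (ho.mem_nhds hw)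

lemma ne_zero_of_mem_quarterPlanes {σ η : ℝ} (hη : 0 < η) {w : ℂ} (hw : w ∈ quarterPlanes σ η) :
    w.im ≠ 0 ∧ w ≠ 0 := by
  have h : w.im ≠ 0 := abs_pos.mp (hη.trans hw.2)
  exact ⟨h, by rintro rfl; simp at h⟩

lemma re_logDeriv_riemannZeta_one_sub_ge {η : ℝ} (hη : 0 < η) (M : ℝ) :
    ∃ N : ℕ, ∀ w ∈ quarterPlanes N η, M ≤ (logDeriv (fun z ↦ riemannZeta (1 - z)) w).re := by
  obtain ⟨C, hC⟩ := norm_zetaLogDerivRemainder_le hη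
  -- `log (N + 1)` must outweigh `M`, the remainder bound `C`, and the `2` lost in `re_digamma_ge`.
  obtain ⟨N, hN⟩ := exists_nat_ge (Real.exp (M + C + 2))
  refine ⟨N + 2, fun w hw ↦ ?_⟩
  have hre := hw.1
  push_cast at hre
  have hN0 : (0 : ℝ) ≤ N := N.cast_nonneg
  rw [(logDeriv_riemannZeta_one_sub (by linarith) (ne_zero_of_mem_quarterPlanes hη hw).1).2, add_re]
  have h1 := re_digamma_ge N (w := w) (by linarith)
  have h2 := (abs_re_le_norm _).trans
    (hC w (quarterPlanes_mono (by push_cast; linarith) le_rfl hw))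
  have h3 := (abs_le.mp h2).1
  have h4 : M + C + 2 ≤ Real.log (N + 1) :=
    (Real.le_log_iff_exp_le (by positivity)).mpr (by linarith)
  linarith

lemma hasLargeLogDeriv_riemannZeta_one_sub {η : ℝ} (hη : 0 < η) :
    HasLargeLogDeriv (fun z ↦ riemannZeta (1 - z)) η := by
  set f : ℂ → ℂ := fun z ↦ riemannZeta (1 - z)
  have hd : ∀ η : ℝ, 0 < η → ∀ σ, DifferentiableOn ℂ f (quarterPlanes σ η) := fun η hη σ w hw ↦
    (differentiableAt_riemannZeta_one_sub
      (ne_zero_of_mem_quarterPlanes hη hw).2).differentiableWithinAt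
  constructor
  · obtain ⟨C₁, h1⟩ := norm_deriv_digamma_le
    obtain ⟨C₂, h2⟩ := norm_zetaLogDerivRemainder_le (half_pos hη)
    have hsub : quarterPlanes (2 + 1) η ⊆ quarterPlanes 2 (η / 2) :=
      quarterPlanes_mono (by norm_num) (by linarith)
    have hU := isOpen_quarterPlanes 2 (η / 2)
    have hlog : ∀ w ∈ quarterPlanes 2 (η / 2), f w ≠ 0 ∧
        logDeriv f w = digamma w + zetaLogDerivRemainder w := fun w hw ↦
      logDeriv_riemannZeta_one_sub (by linarith [hw.1])
        (ne_zero_of_mem_quarterPlanes (half_pos hη) hw).1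
    have hdig : DifferentiableOn ℂ digamma (quarterPlanes 2 (η / 2)) := fun w hw ↦
      (differentiableAt_digamma (by linarith [hw.1])).differentiableWithinAt
    -- The remainder is holomorphic as the difference of `logDeriv f` and digamma.
    have hrem : DifferentiableOn ℂ zetaLogDerivRemainder (quarterPlanes 2 (η / 2)) := by
      refine (((hd _ (half_pos hη) 2).logDeriv_of_isOpen hU fun w hw ↦ (hlog w hw).1).sub
        hdig).congr fun w hw ↦ ?_
      rw [Pi.sub_apply, (hlog w hw).2]
      ring
    refine ⟨2 + 1, C₁ + C₂ / min 1 (η / 2), hd η hη _, fun w hw ↦ (hlog w (hsub hw)).1,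
      fun w hw ↦ ?_⟩
    have hwU := hU.mem_nhds (hsub hw)
    have hev : logDeriv f =ᶠ[𝓝 w] fun z ↦ digamma z + zetaLogDerivRemainder z := by
      filter_upwards [hwU] with z hz using (hlog z hz).2
    rw [hev.deriv_eq, deriv_fun_add (hdig.differentiableAt hwU) (hrem.differentiableAt hwU)]
    exact (norm_add_le _ _).trans (add_le_add (h1 w (by linarith [hw.1]))
      (norm_deriv_le_of_bounded_quarterPlanes hη hrem h2 hw))
  · intro M
    obtain ⟨N, hN⟩ := re_logDeriv_riemannZeta_one_sub_ge hη M
    exact ⟨N, fun w hw ↦ (hN w hw).trans (re_le_norm _)⟩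

/-! ### Lower bound for `ζ (1 - w)` by horizontal monotonicity -/

/-- If `re (f' / f) ≥ 0` along a horizontal half-line, then `‖f‖` is nondecreasing there. -/
lemma norm_le_norm_of_re_logDeriv_nonneg {f : ℂ → ℂ} {w : ℂ} {x₀ : ℝ} (hx : x₀ ≤ w.re)
    (hd : ∀ x : ℝ, x₀ ≤ x → DifferentiableAt ℂ f (x + w.im * I))
    (h0 : ∀ x : ℝ, x₀ < x → 0 ≤ (logDeriv f (x + w.im * I)).re) :
    ‖f (x₀ + w.im * I)‖ ≤ ‖f w‖ := by
  set g : ℝ → ℂ := fun x ↦ f (x + w.im * I)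
  have hg : ∀ x, x₀ ≤ x → HasDerivAt g (deriv f (x + w.im * I)) x := fun x hx ↦ by
    have h1 : HasDerivAt (fun t : ℂ ↦ t + w.im * I) 1 (x : ℂ) := (hasDerivAt_id _).add_const _
    have h2 : HasDerivAt (fun t : ℂ ↦ f (t + w.im * I)) _ (x : ℂ) :=
      (hd x hx).hasDerivAt.comp (x : ℂ) h1
    simpa using h2.comp_ofReal
  -- The squared norm is differentiable even at zeros of `g`, with derivative `2 re (conj g * g')`.
  have hmono : MonotoneOn (fun x ↦ ‖g x‖ ^ 2) (Set.Ici x₀) := by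
    refine monotoneOn_of_hasDerivWithinAt_nonneg (convex_Ici x₀)
      (fun x hx ↦ (hg x hx).norm_sq.continuousAt.continuousWithinAt)
      (fun x hx ↦ (hg x (interior_subset hx)).norm_sq.hasDerivWithinAt) fun x hx ↦ ?_
    rw [interior_Ici] at hx
    have h1 := h0 x hx
    rw [logDeriv_apply, div_re] at h1
    by_cases hz : g x = 0
    · simp [hz]
    have h3 : 0 < normSq (f (x + w.im * I)) := normSq_pos.mpr hz
    rw [← add_div, le_div_iff₀ h3, zero_mul] at h1
    rw [Complex.inner, mul_re, conj_re, conj_im]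
    simp only [g]
    nlinarith
  have h := hmono (Set.mem_Ici.mpr le_rfl) (Set.mem_Ici.mpr hx) hx
  simp only [g, re_add_im] at h
  exact (pow_le_pow_iff_left₀ (norm_nonneg _) (norm_nonneg _) two_ne_zero).mp h

lemma norm_riemannZeta_one_sub_ge :
    ∃ c σ : ℝ, 0 < c ∧ ∀ w ∈ quarterPlanes σ (1 / 2), c ≤ ‖riemannZeta (1 - w)‖ := by
  obtain ⟨N, hN⟩ := re_logDeriv_riemannZeta_one_sub_ge (η := 1 / 2) (by norm_num) 0
  obtain ⟨c, hc, h⟩ := norm_riemannZeta_one_sub_nat_ge N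
  refine ⟨c, N + 2, hc, fun w hw ↦ ?_⟩
  have h1 := h (((N + 2 : ℝ) : ℂ) + w.im * I) (by simp) (by simpa using hw.2.le)
  refine h1.trans (norm_le_norm_of_re_logDeriv_nonneg (f := fun z ↦ riemannZeta (1 - z)) hw.1.le
    (fun x hx ↦ differentiableAt_riemannZeta_one_sub ?_) fun x hx ↦ hN _ ⟨?_, ?_⟩)
  · intro h0
    have := congrArg re h0
    simp at this
    linarith [(N.cast_nonneg : (0 : ℝ) ≤ N)]
  · simp; linarith
  · simpa using hw.2

/-! ### Dirichlet series of the derivatives in the right half-plane -/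

/-- For `n ≥ N`, `n ^ (-re s) ≤ N ^ (2 - re s) * n ^ (-2)`: the first possible nonzero index sets
the decay rate. -/
lemma norm_LSeries_le_rpow {f : ℕ → ℂ} (hf : LSeriesSummable f 2) {N : ℕ} (hN : 1 ≤ N)
    (h0 : ∀ n, 0 < n → n < N → f n = 0) :
    ∃ K : ℝ, 0 ≤ K ∧ ∀ s : ℂ, 2 ≤ s.re → ‖LSeries f s‖ ≤ (N : ℝ) ^ (2 - s.re) * K := by
  refine ⟨∑' n, ‖LSeries.term f 2 n‖, tsum_nonneg fun _ ↦ norm_nonneg _, fun s hs ↦ ?_⟩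
  refine tsum_of_norm_bounded ((Summable.norm hf).hasSum.mul_left _) fun n ↦ ?_
  rw [LSeries.norm_term_eq, LSeries.norm_term_eq]
  split_ifs with hn
  · simp
  rcases lt_or_ge n N with h | h
  · simp [h0 n (Nat.pos_of_ne_zero hn) h]
  have hn0 : (0 : ℝ) < n := by exact_mod_cast Nat.pos_of_ne_zero hn
  have h1 : (n : ℝ) ^ (2 - s.re) ≤ (N : ℝ) ^ (2 - s.re) :=
    Real.rpow_le_rpow_of_nonpos (by exact_mod_cast hN) (by exact_mod_cast h) (by linarith)
  have e : ‖f n‖ / (n : ℝ) ^ s.re = (n : ℝ) ^ (2 - s.re) * (‖f n‖ / (n : ℝ) ^ (2 : ℂ).re) := by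
    rw [Real.rpow_sub hn0]
    simp only [re_ofNat]
    have : (n : ℝ) ^ (2 : ℝ) ≠ 0 := (Real.rpow_pos_of_pos hn0 _).ne'
    field_simp
  rw [e]
  gcongr

lemma logMul_iterate_one (k n : ℕ) : LSeries.logMul^[k] 1 n = (log n) ^ k := by
  induction k with
  | zero => simp
  | succ k ih => rw [Function.iterate_succ', Function.comp_apply, LSeries.logMul, ih, pow_succ']

lemma iteratedDeriv_riemannZeta_eq_LSeries (k : ℕ) {s : ℂ} (hs : 1 < s.re) :
    iteratedDeriv k riemannZeta s = (-1) ^ k * LSeries (fun n ↦ (log n) ^ k) s := by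
  have hev : riemannZeta =ᶠ[𝓝 s] LSeries 1 := by
    filter_upwards [(isOpen_lt continuous_const continuous_re).mem_nhds hs] with z hz
    exact (LSeries_one_eq_riemannZeta hz).symm
  have ha : LSeries.abscissaOfAbsConv 1 < s.re := by
    rw [LSeries.abscissaOfAbsConv_one]; exact_mod_cast hs
  rw [hev.iteratedDeriv_eq, LSeries_iteratedDeriv k ha]
  congr 2
  exact funext (logMul_iterate_one k)

lemma LSeriesSummable_log_pow (k : ℕ) : LSeriesSummable (fun n ↦ (log n) ^ k) 2 := by
  rw [← funext (logMul_iterate_one k)]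
  refine LSeriesSummable_of_abscissaOfAbsConv_lt_re ?_
  rw [LSeries.absicssaOfAbsConv_logPowMul, LSeries.abscissaOfAbsConv_one, re_ofNat]
  exact_mod_cast one_lt_two

lemma eventually_rpow_mul_lt {b : ℝ} (hb0 : 0 < b) (hb : b < 1) (K : ℝ) {ε : ℝ} (hε : 0 < ε) :
    ∃ E : ℝ, ∀ x : ℝ, E ≤ x → b ^ x * K < ε := by
  have h := (tendsto_rpow_atTop_of_base_lt_one b (by linarith) hb).mul_const K
  rw [zero_mul] at h
  exact eventually_atTop.mp (h.eventually_lt_const hε)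

lemma norm_iteratedDeriv_riemannZeta_lt {k : ℕ} (hk : 1 ≤ k) {ε : ℝ} (hε : 0 < ε) :
    ∃ E : ℝ, ∀ s : ℂ, E ≤ s.re → ‖iteratedDeriv k riemannZeta s‖ < ε := by
  obtain ⟨K, -, hK⟩ := norm_LSeries_le_rpow (LSeriesSummable_log_pow k) one_le_two
    fun n h1 h2 ↦ by
      obtain rfl : n = 1 := by omega
      simp; omega
  -- `2 ^ (2 - x) = 4 * (1 / 2) ^ x`.
  obtain ⟨E, hE⟩ := eventually_rpow_mul_lt (b := 1 / 2) (by norm_num) (by norm_num) (4 * K) hε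
  refine ⟨max 2 E, fun s hs ↦ ?_⟩
  have h2 : 2 ≤ s.re := (le_max_left _ _).trans hs
  rw [iteratedDeriv_riemannZeta_eq_LSeries k (by linarith), norm_mul, norm_pow, norm_neg, norm_one,
    one_pow, one_mul]
  refine (hK s h2).trans_lt (lt_of_eq_of_lt ?_ (hE s.re ((le_max_right _ _).trans hs)))
  rw [one_div, Real.inv_rpow zero_le_two, Nat.cast_ofNat, Real.rpow_sub two_pos]
  norm_num
  ring

/-- A zero would force the `n = 2` term, of size `(log 2)^k / 2 ^ re s`, to equal in norm the tail
from `n = 3`, which is at most `K * 3 ^ (2 - re s)`. The ratio `9K (2/3) ^ re s / (log 2)^k` tends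
to `0`. -/
lemma iteratedDeriv_riemannZeta_ne_zero {k : ℕ} (hk : 1 ≤ k) :
    ∃ E : ℝ, ∀ s : ℂ, E ≤ s.re → iteratedDeriv k riemannZeta s ≠ 0 := by
  set f : ℕ → ℂ := fun n ↦ (log n) ^ k
  set g : ℕ → ℂ := fun n ↦ if n = 2 then 0 else f n
  have hterm : ∀ s n, LSeries.term g s n = if n = 2 then 0 else LSeries.term f s n := by
    intro s n
    simp only [LSeries.term, g]
    split_ifs <;> simp
  have hg : LSeriesSummable g 2 := by
    refine Summable.of_norm_bounded (Summable.norm (LSeriesSummable_log_pow k)) fun n ↦ ?_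
    rw [hterm]
    split_ifs
    · simp
    · exact le_rfl
  obtain ⟨K, -, hK⟩ := norm_LSeries_le_rpow hg (N := 3) (by norm_num) fun n h1 h2 ↦ by
    simp only [g, f]
    split_ifs with h
    · rfl
    · obtain rfl : n = 1 := by omega
      simp; omega
  have hlog : 0 < Real.log 2 ^ k := pow_pos (Real.log_pos one_lt_two) k
  obtain ⟨E, hE⟩ := eventually_rpow_mul_lt (b := 2 / 3) (by norm_num) (by norm_num) (9 * K) hlog
  refine ⟨max 2 E, fun s hs h0 ↦ ?_⟩
  have h2 : 2 ≤ s.re := (le_max_left _ _).trans hs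
  have hsum : LSeriesSummable f s :=
    (LSeriesSummable_log_pow k).of_re_le_re (by simpa using h2)
  have hsplit : LSeries f s = LSeries.term f s 2 + LSeries g s := by
    rw [LSeries, hsum.tsum_eq_add_tsum_ite 2, LSeries]
    exact congrArg _ (tsum_congr fun n ↦ (hterm s n).symm)
  rw [iteratedDeriv_riemannZeta_eq_LSeries k (by linarith), mul_eq_zero] at h0
  have h1 : LSeries f s = 0 := h0.resolve_left (pow_ne_zero k (by norm_num))
  have h3 : ‖LSeries.term f s 2‖ = ‖LSeries g s‖ := by
    rw [← norm_neg (LSeries g s)]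
    congr 1
    linear_combination h1 - hsplit
  have h4 : ‖LSeries.term f s 2‖ = Real.log 2 ^ k / 2 ^ s.re := by
    rw [LSeries.norm_term_eq, if_neg two_ne_zero]
    have : log ((2 : ℕ) : ℂ) = (Real.log 2 : ℝ) := by rw [ofReal_log zero_le_two]; simp
    simp only [f]
    rw [this, norm_pow, norm_real, Real.norm_of_nonneg (Real.log_pos one_lt_two).le,
      Nat.cast_ofNat]
  have h5 := hK s h2
  rw [← h3, h4, div_le_iff₀ (by positivity)] at h5
  have h6 := hE s.re ((le_max_right _ _).trans hs)
  have e : ((3 : ℕ) : ℝ) ^ (2 - s.re) * K * 2 ^ s.re = (2 / 3) ^ s.re * (9 * K) := by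
    rw [Real.div_rpow zero_le_two (by norm_num), Nat.cast_ofNat, Real.rpow_sub three_pos]
    norm_num
    ring
  exact (h5.trans_eq e).not_gt h6

/-! ### The left region and the conclusion -/

lemma norm_iteratedDeriv_riemannZeta_gt {k : ℕ} (hk : 1 ≤ k) (A : ℝ) :
    ∃ E : ℝ, ∀ s : ℂ, s.re ≤ E → 1 ≤ |s.im| → A < ‖iteratedDeriv k riemannZeta s‖ := by
  obtain ⟨c, σ₁, hc, h1⟩ := norm_riemannZeta_one_sub_ge
  -- `M ≥ 1` gives `M ≤ M ^ k`, and the other entry gives `M * c ≥ |A| + 1`.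
  set M : ℝ := max 1 ((|A| + 1) / c)
  have hM : 1 ≤ M := le_max_left _ _
  obtain ⟨σ₂, h2⟩ := HasLargeLogDeriv.norm_iteratedDeriv_ge
    (fun η hη ↦ hasLargeLogDeriv_riemannZeta_one_sub hη) (η := 1 / 2) (M := M)
    (by norm_num) (by linarith) k
  refine ⟨-max σ₁ σ₂, fun s hs him ↦ ?_⟩
  have hw : ∀ σ, σ ≤ max σ₁ σ₂ → 1 - s ∈ quarterPlanes σ (1 / 2) := fun σ hσ ↦
    ⟨by rw [sub_re, one_re]; linarith, by
      rw [sub_im, one_im, zero_sub, abs_neg]; linarith⟩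
  have h3 := h1 _ (hw σ₁ (le_max_left _ _))
  have h4 := h2 _ (hw σ₂ (le_max_right _ _))
  rw [iteratedDeriv_comp_const_sub] at h4
  simp only [sub_sub_cancel, smul_eq_mul, norm_mul, norm_pow, norm_neg, norm_one, one_pow,
    one_mul] at h3 h4
  refine lt_of_lt_of_le ?_ h4
  calc A < |A| + 1 := by linarith [le_abs_self A]
    _ = (|A| + 1) / c * c := by field_simp
    _ ≤ M ^ k * ‖riemannZeta s‖ := by
      gcongr
      exact (le_max_right _ _).trans (le_self_pow₀ hM (by omega))

theorem theorem2p1 (k : ℕ) (hk : 1 ≤ k) (a : ℂ) :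
    ∃ E₁ E₂ : ℝ, E₁ ≤ 0 ∧ 1 ≤ E₂ ∧
      (∀ s : ℂ, s.re ≤ E₁ → 1 ≤ |s.im| → ‖a‖ < ‖iteratedDeriv k riemannZeta s‖) ∧
      (a ≠ 0 → ∀ s : ℂ, E₂ ≤ s.re → ‖iteratedDeriv k riemannZeta s‖ < ‖a‖) ∧
      (∀ s : ℂ, (s.re ≤ E₁ ∧ 1 ≤ |s.im|) ∨ E₂ ≤ s.re →
        iteratedDeriv k riemannZeta s ≠ a) := by
  obtain ⟨E₁, h1⟩ := norm_iteratedDeriv_riemannZeta_gt hk ‖a‖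
  obtain ⟨E₂, h2⟩ : ∃ E : ℝ, ∀ s : ℂ, E ≤ s.re →
      (a ≠ 0 → ‖iteratedDeriv k riemannZeta s‖ < ‖a‖) ∧ iteratedDeriv k riemannZeta s ≠ a := by
    -- For `a ≠ 0` smallness already excludes `a`-points; `a = 0` needs the nonvanishing result.
    by_cases ha : a = 0
    · subst ha
      obtain ⟨E, hE⟩ := iteratedDeriv_riemannZeta_ne_zero hk
      exact ⟨E, fun s hs ↦ ⟨fun h ↦ absurd rfl h, hE s hs⟩⟩
    · obtain ⟨E, hE⟩ := norm_iteratedDeriv_riemannZeta_lt hk (norm_pos_iff.mpr ha)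
      exact ⟨E, fun s hs ↦ ⟨fun _ ↦ hE s hs, fun h ↦ (h ▸ hE s hs).false⟩⟩
  refine ⟨min E₁ 0, max E₂ 1, min_le_right _ _, le_max_right _ _,
    fun s hs him ↦ h1 s (hs.trans (min_le_left _ _)) him,
    fun ha s hs ↦ (h2 s ((le_max_left _ _).trans hs)).1 ha, ?_⟩
  rintro s (⟨hs, him⟩ | hs)
  · exact fun h ↦ (h ▸ h1 s (hs.trans (min_le_left _ _)) him).false
  · exact (h2 s ((le_max_left _ _).trans hs)).2
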